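/- All graphs are finite and simple. A \(k\)-star colouring of a graph \(G\) is a proper vertex colouring of \(G\) with \(k\) colours such that every connected component of the subgraph induced by any two colour classes is a star \(K_{1,q}\) with \(q \ge 0\). Let \(G\) be a 4-regular graph that has no induced subgraph isomorphic to the claw \(K_{1,3}\) and that admits a 4-star colouring. Then \(G\) is isomorphic to the line graph of a bipartite 3-regular graph. In particular, \(G\) is odd-hole-free, i.e., \(G\) has no induced cycle of odd length at least 5. -/

import Mathlib

/-- `G` is `H`-free: no induced subgraph of `G` is isomorphic to `H`. -/
def SimpleGraph.InducedFree {V W : Type*} (G : SimpleGraph V) (H : SimpleGraph W) : Prop :=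
  ¬ H.IsIndContained G

/-- `G` is claw-free, the claw being `K_{1,3}`. -/
def SimpleGraph.ClawFree {V : Type*} (G : SimpleGraph V) : Prop :=
  G.InducedFree (completeBipartiteGraph (Fin 1) (Fin 3))

/-- `G` has no induced odd cycle of length at least `5`. -/
def SimpleGraph.OddHoleFree {V : Type*} (G : SimpleGraph V) : Prop :=
  ∀ q : ℕ, 1 ≤ q → G.InducedFree (SimpleGraph.cycleGraph (2 * q + 3))

/-- `G` is a star `K_{1,q}` for some `q ≥ 0`. -/
def SimpleGraph.IsStar {V : Type*} (G : SimpleGraph V) : Prop :=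
  ∃ q : ℕ, Nonempty (G ≃g completeBipartiteGraph (Fin 1) (Fin q))

/-- A (proper) `k`-colouring is a `k`-star colouring if every connected component of the subgraph
induced by two colour classes is a star. -/
def SimpleGraph.IsStarColoring {V : Type*} {G : SimpleGraph V} {k : ℕ}
    (f : G.Coloring (Fin k)) : Prop :=
  ∀ i j : Fin k, i ≠ j →
    ∀ c : (G.induce (f ⁻¹' {i} ∪ f ⁻¹' {j})).ConnectedComponent, c.toSimpleGraph.IsStar

/-- `G` admits a `k`-star colouring. -/
def SimpleGraph.StarColorable {V : Type*} (G : SimpleGraph V) (k : ℕ) : Prop :=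
  ∃ f : G.Coloring (Fin k), SimpleGraph.IsStarColoring f

/-!
In a star colouring, each edge `uv` makes `u` the only neighbour of `v` of its colour, or vice
versa: otherwise a bicoloured path on four vertices passes through `uv`. In a `2p`-regular graph
with `p + 2` colours, where `p ≥ 2`, a vertex has at most `p` uniquely coloured neighbours, so
counting over all edges makes every inequality an equality: pointing each edge away from the
uniquely coloured end yields an Eulerian orientation in which in-neighbours have distinct colours
and out-neighbours share a colour.

For `p = 2`, claw-freeness at the head of an arc completes the arc to a directed triangle. View the
four colours as the vertices of a tetrahedron, so that a directed triangle runs around a face,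
clockwise as seen from the outside or from the inside. The two triangles at a vertex run along
faces that share an edge, traversed in the same direction, so they are of opposite kinds. Hence `G`
is the edge-disjoint union of two 2-regular graphs whose components are triangles. The triangles of
the two kinds are the two sides of a bipartite cubic graph, in which a vertex of `G` is the edge
joining its two triangles.

Along an odd hole in the line graph of a bipartite graph, the end shared by consecutive edges would
alternate between the two colour classes, 2-colouring an odd cycle.
-/

open SimpleGraph

section

variable {V W : Type*} {G : SimpleGraph V}

theorem degree_eq_ncard_neighborSet (v : V) [Fintype (G.neighborSet v)] :
    G.degree v = (G.neighborSet v).ncard := by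
  rw [← card_neighborSet_eq_degree, Fintype.card_eq_nat_card, Nat.card_coe_set_eq]

section StarColoring

variable {k p : ℕ} {f : G.Coloring (Fin k)} {u v w x : V}

theorem exists_center_of_isStar (hG : G.IsStar) : ∃ c, ∀ u v, G.Adj u v → u = c ∨ v = c := by
  obtain ⟨q, ⟨e⟩⟩ := hG
  refine ⟨e.symm (.inl 0), fun u v huv => ?_⟩
  have hstar := e.map_adj_iff.2 huv
  rw [← e.apply_eq_iff_eq (x := u), ← e.apply_eq_iff_eq (x := v), e.apply_symm_apply]
  rcases hu : e u with i | i <;> rcases hv : e v with j | j <;>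
    simp_all [Subsingleton.elim _ (0 : Fin 1), completeBipartiteGraph_adj]

theorem eq_or_eq_of_bicolored_path (hf : IsStarColoring f) (huv : G.Adj u v) (hvw : G.Adj v w)
    (hwx : G.Adj w x) (huw : f u = f w) (hvx : f v = f x) : u = w ∨ v = x := by
  have hne : f u ≠ f v := f.valid huv
  let S : Set V := f ⁻¹' {f u} ∪ f ⁻¹' {f v}
  let u' : S := ⟨u, by simp [S]⟩
  let v' : S := ⟨v, by simp [S]⟩
  let w' : S := ⟨w, by simp [S, huw]⟩
  let x' : S := ⟨x, by simp [S, hvx]⟩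
  let c := (G.induce S).connectedComponentMk u'
  have hu : u' ∈ c := rfl
  have hv : v' ∈ c := c.mem_supp_of_adj_mem_supp hu huv
  have hw : w' ∈ c := c.mem_supp_of_adj_mem_supp hv hvw
  have hx : x' ∈ c := c.mem_supp_of_adj_mem_supp hw hwx
  obtain ⟨z, hz⟩ := exists_center_of_isStar (hf _ _ hne c)
  have huv_center := hz _ _ ((c.toSimpleGraph_adj hu hv).2 huv)
  have hwx_center := hz _ _ ((c.toSimpleGraph_adj hw hx).2 hwx)
  have hux : u ≠ x := fun h => hne (by rw [hvx, h])
  grind [hvw.ne]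

/-- `u` is a neighbour of `v` and no other neighbour of `v` has the colour of `u`. -/
def IsUniqueNeighbor (f : G.Coloring (Fin k)) (v u : V) : Prop :=
  G.Adj v u ∧ ∀ w, G.Adj v w → f w = f u → w = u

theorem isUniqueNeighbor_or_isUniqueNeighbor (hf : IsStarColoring f) (huv : G.Adj u v) :
    IsUniqueNeighbor f u v ∨ IsUniqueNeighbor f v u := by
  by_contra! h
  simp only [IsUniqueNeighbor, huv, huv.symm, true_and, not_forall] at h
  obtain ⟨⟨x, hux, hxv, hx⟩, y, hvy, hyu, hy⟩ := h
  rcases eq_or_eq_of_bicolored_path hf hux.symm huv hvy hxv hyu.symm with h | h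
  exacts [hx h, hy h.symm]

theorem injOn_setOf_isUniqueNeighbor (f : G.Coloring (Fin k)) (v : V) :
    Set.InjOn f {u | IsUniqueNeighbor f v u} :=
  fun _ ha _ hb hab => hb.2 _ ha.1 hab

theorem ncard_image_setOf_isUniqueNeighbor (f : G.Coloring (Fin k)) (v : V) :
    (f '' {u | IsUniqueNeighbor f v u}).ncard = {u | IsUniqueNeighbor f v u}.ncard :=
  (injOn_setOf_isUniqueNeighbor f v).ncard_image

theorem image_setOf_isUniqueNeighbor_subset (f : G.Coloring (Fin k)) (v : V) :
    f '' {u | IsUniqueNeighbor f v u} ⊆ {f v}ᶜ := by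
  rintro _ ⟨u, hu, rfl⟩
  exact (f.valid hu.1).symm

theorem isUniqueNeighbor_of_color_mem_image (huv : G.Adj v u)
    (hu : f u ∈ f '' {u | IsUniqueNeighbor f v u}) : IsUniqueNeighbor f v u := by
  obtain ⟨w, hw, hwu⟩ := hu
  rwa [hw.2 u huv hwu.symm]

theorem ncard_compl_singleton_fin (c : Fin (p + 2)) : ({c}ᶜ : Set (Fin (p + 2))).ncard = p + 1 := by
  rw [Set.ncard_compl, Nat.card_eq_fintype_card, Fintype.card_fin, Set.ncard_singleton]
  rfl

theorem ncard_setOf_isUniqueNeighbor_le [G.LocallyFinite] (hp : 2 ≤ p)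
    (hreg : G.IsRegularOfDegree (2 * p)) (f : G.Coloring (Fin (p + 2))) (v : V) :
    {u | IsUniqueNeighbor f v u}.ncard ≤ p := by
  by_contra! hlt
  have himage : f '' {u | IsUniqueNeighbor f v u} = {f v}ᶜ :=
    Set.eq_of_subset_of_ncard_le (image_setOf_isUniqueNeighbor_subset f v) <| by
      rwa [ncard_compl_singleton_fin, ncard_image_setOf_isUniqueNeighbor]
  have hall : {u | IsUniqueNeighbor f v u} = G.neighborSet v :=
    Set.Subset.antisymm (fun u hu => hu.1) fun u hu =>
      isUniqueNeighbor_of_color_mem_image hu (himage ▸ (f.valid hu).symm)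
  have hdeg : (G.neighborSet v).ncard = 2 * p := by
    rw [← degree_eq_ncard_neighborSet, hreg v]
  have : {u | IsUniqueNeighbor f v u}.ncard = p + 1 := by
    rw [← ncard_image_setOf_isUniqueNeighbor, himage, ncard_compl_singleton_fin]
  rw [hall] at this
  omega

theorem color_eq_of_not_isUniqueNeighbor {f : G.Coloring (Fin (p + 2))}
    (hcard : {u | IsUniqueNeighbor f v u}.ncard = p) (hvu : G.Adj v u) (hvw : G.Adj v w)
    (hu : ¬ IsUniqueNeighbor f v u) (hw : ¬ IsUniqueNeighbor f v w) : f u = f w := by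
  have hfree : ({f v}ᶜ \ f '' {u | IsUniqueNeighbor f v u}).ncard = 1 := by
    rw [Set.ncard_sdiff (image_setOf_isUniqueNeighbor_subset f v), ncard_compl_singleton_fin,
      ncard_image_setOf_isUniqueNeighbor, hcard, Nat.add_sub_cancel_left]
  have hmem {x : V} (hvx : G.Adj v x) (hx : ¬ IsUniqueNeighbor f v x) :
      f x ∈ {f v}ᶜ \ f '' {u | IsUniqueNeighbor f v u} :=
    ⟨(f.valid hvx).symm, fun h => hx (isUniqueNeighbor_of_color_mem_image hvx h)⟩
  exact (Set.ncard_le_one_iff).1 hfree.le (hmem hvu hu) (hmem hvw hw)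

end StarColoring

section Orientation

variable {A : V → V → Prop} {p : ℕ}

theorem sum_ncard_out_eq_sum_ncard_in [Fintype V] (A : V → V → Prop) :
    ∑ v, {u | A v u}.ncard = ∑ v, {u | A u v}.ncard := by
  classical
  simpa [Set.ncard_eq_toFinset_card', Finset.bipartiteAbove, Finset.bipartiteBelow] using
    Finset.sum_card_bipartiteAbove_eq_sum_card_bipartiteBelow (s := Finset.univ)
      (t := Finset.univ) A

theorem balanced_of_ncard_in_le [Finite V] [G.LocallyFinite] (hreg : G.IsRegularOfDegree (2 * p))
    (hA : ∀ u v, G.Adj u v ↔ A u v ∨ A v u) (hle : ∀ v, {u | A u v}.ncard ≤ p) (v : V) :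
    {u | A v u}.ncard = p ∧ {u | A u v}.ncard = p ∧ Disjoint {u | A v u} {u | A u v} := by
  cases nonempty_fintype V
  have hunion (v : V) : ({u | A v u} ∪ {u | A u v}).ncard = 2 * p := by
    rw [← hreg v, degree_eq_ncard_neighborSet]
    congr 1
    ext u
    exact (hA v u).symm
  have hge (v : V) : p ≤ {u | A v u}.ncard := by
    have := Set.ncard_union_le {u | A v u} {u | A u v}
    have := hunion v
    have := hle v
    omega
  have heq : {u | A u v}.ncard = {u | A v u}.ncard :=
    (Finset.sum_eq_sum_iff_of_le fun v _ => (hle v).trans (hge v)).1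
      (sum_ncard_out_eq_sum_ncard_in A).symm v (Finset.mem_univ v)
  have hin := (hle v).antisymm (heq ▸ hge v)
  have hout := heq ▸ hin
  refine ⟨hout, hin, (Set.ncard_union_eq_iff).1 ?_⟩
  rw [hunion, hin, hout, two_mul]

/-- A colourful Eulerian orientation of a `2p`-regular graph with proper colouring `f`, given by
its arc relation `A`: the `p` in-neighbours of a vertex have distinct colours, and its
`p` out-neighbours share one colour. -/
structure IsColorfulEulerianOrientation {α : Type*} (f : G.Coloring α) (A : V → V → Prop)
    (p : ℕ) : Prop where
  adj_iff : ∀ u v, G.Adj u v ↔ A u v ∨ A v u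
  asymm : ∀ u v, A u v → ¬ A v u
  ncard_out : ∀ v, {w | A v w}.ncard = p
  ncard_in : ∀ v, {u | A u v}.ncard = p
  eq_of_in : ∀ u v w, A u v → A w v → f u = f w → u = w
  color_out : ∀ u v w, A v u → A v w → f u = f w

theorem isColorfulEulerianOrientation_isUniqueNeighbor [Finite V] [G.LocallyFinite] (hp : 2 ≤ p)
    (hreg : G.IsRegularOfDegree (2 * p)) {f : G.Coloring (Fin (p + 2))} (hf : IsStarColoring f) :
    IsColorfulEulerianOrientation f (fun u v => IsUniqueNeighbor f v u) p := by
  have hadj (u v : V) : G.Adj u v ↔ IsUniqueNeighbor f v u ∨ IsUniqueNeighbor f u v :=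
    ⟨fun h => isUniqueNeighbor_or_isUniqueNeighbor hf h.symm,
      fun h => h.elim (fun h => h.1.symm) fun h => h.1⟩
  have hbal := balanced_of_ncard_in_le hreg hadj (ncard_setOf_isUniqueNeighbor_le hp hreg f)
  have hasymm (u v : V) (huv : IsUniqueNeighbor f v u) : ¬ IsUniqueNeighbor f u v :=
    fun hvu => Set.disjoint_left.1 (hbal v).2.2 hvu huv
  exact
    { adj_iff := hadj
      asymm := hasymm
      ncard_out := fun v => (hbal v).1
      ncard_in := fun v => (hbal v).2.1
      eq_of_in := fun u v w hu hw huw => hw.2 u hu.1 huw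
      color_out := fun u v w hu hw => color_eq_of_not_isUniqueNeighbor (hbal v).2.1
        hu.1.symm hw.1.symm (hasymm _ _ hu) (hasymm _ _ hw) }

end Orientation

section OrientedTriangles

theorem adj_or_adj_or_adj_of_clawFree (hG : G.ClawFree) {v x y z : V} (hx : G.Adj v x)
    (hy : G.Adj v y) (hz : G.Adj v z) (hxy : x ≠ y) (hxz : x ≠ z) (hyz : y ≠ z) :
    G.Adj x y ∨ G.Adj x z ∨ G.Adj y z := by
  by_contra! hindep
  have hinj : Function.Injective ![x, y, z] := by
    simp [Function.Injective, Fin.forall_fin_succ, hxy, hxz, hyz, hxy.symm, hxz.symm, hyz.symm]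
  have hcenter : ∀ i, G.Adj v (![x, y, z] i) := by simp [Fin.forall_fin_succ, hx, hy, hz]
  have hleaves : ∀ i j, ¬ G.Adj (![x, y, z] i) (![x, y, z] j) := by
    simp [Fin.forall_fin_succ, hindep, G.adj_comm y x, G.adj_comm z]
  refine hG ⟨⟨⟨Sum.elim (fun _ => v) ![x, y, z], ?_⟩, ?_⟩⟩
  · exact (Function.injective_of_subsingleton _).sumElim hinj fun _ i => (hcenter i).ne
  · rintro (i | i) (j | j) <;> simp [hcenter, (hcenter _).symm, hleaves]

/-- The side of the tetrahedron with vertices `0, 1, 2, 3` from which the face `a, b, c`, traversed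
in this order, runs clockwise. Equivalently, the parity of the permutation `a, b, c, d`, where
`d` is the fourth element; the parities of `d` and `a + b + c` agree. -/
def faceSide (a b c : Fin 4) : Bool :=
  xor (decide (a < b ∧ b < c ∨ b < c ∧ c < a ∨ c < a ∧ a < b))
    (decide (Even (a.val + b.val + c.val)))

theorem faceSide_rotate : ∀ a b c : Fin 4, faceSide b c a = faceSide a b c := by
  decide

theorem eq_of_faceSide_eq : ∀ a a' b c : Fin 4, a ≠ b → a ≠ c → a' ≠ b → a' ≠ c → b ≠ c →
    faceSide a b c = faceSide a' b c → a = a' := by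
  decide

/-- `u → v → w → u` is a directed triangle for the arc relation `A`, and its colours under `f`
traverse a face of the tetrahedron seen from side `i`. -/
structure IsFaceTriangle (f : G.Coloring (Fin 4)) (A : V → V → Prop) (i : Bool) (u v w : V) :
    Prop where
  arc₁₂ : A u v
  arc₂₃ : A v w
  arc₃₁ : A w u
  side : faceSide (f u) (f v) (f w) = i

theorem IsFaceTriangle.rotate {f : G.Coloring (Fin 4)} {A : V → V → Prop} {i : Bool} {u v w : V}
    (h : IsFaceTriangle f A i u v w) : IsFaceTriangle f A i v w u :=
  ⟨h.arc₂₃, h.arc₃₁, h.arc₁₂, (faceSide_rotate _ _ _).trans h.side⟩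

/-- The graph formed by the edges of all directed triangles of side `i`. -/
def faceTriangleGraph (f : G.Coloring (Fin 4)) (A : V → V → Prop) (i : Bool) : SimpleGraph V :=
  fromRel fun u v => ∃ w, IsFaceTriangle f A i u v w

namespace IsColorfulEulerianOrientation

variable {A : V → V → Prop}

theorem exists_directed_triangle {α : Type*} {f : G.Coloring α}
    (h : IsColorfulEulerianOrientation f A 2) (hclaw : G.ClawFree) {u v : V} (huv : A u v) :
    ∃ w, A v w ∧ A w u := by
  obtain ⟨a, b, hab, hout⟩ := Set.ncard_eq_two.1 (h.ncard_out v)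
  have hva : A v a := (Set.ext_iff.1 hout a).2 (by simp)
  have hvb : A v b := (Set.ext_iff.1 hout b).2 (by simp)
  have hadj {x y : V} (hxy : A x y) : G.Adj x y := (h.adj_iff x y).2 (.inl hxy)
  have hnab : ¬ G.Adj a b := fun hadj_ab => f.valid hadj_ab (h.color_out a v b hva hvb)
  have hback {w : V} (hvw : A v w) (huw : G.Adj u w) : ∃ w, A v w ∧ A w u :=
    ⟨w, hvw, ((h.adj_iff u w).1 huw).resolve_left fun huw =>
      f.valid (hadj hvw) (h.color_out v u w huv huw)⟩
  have hne {w : V} (hvw : A v w) : u ≠ w := fun huw => h.asymm u v huv (huw ▸ hvw)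
  rcases adj_or_adj_or_adj_of_clawFree hclaw (hadj huv).symm (hadj hva) (hadj hvb)
    (hne hva) (hne hvb) hab with hua | hub | hab
  · exact hback hva hua
  · exact hback hvb hub
  · exact (hnab hab).elim

variable {f : G.Coloring (Fin 4)} {p : ℕ} {i j : Bool} {u u' v w w' : V}

theorem eq_and_eq_of_isFaceTriangle (h : IsColorfulEulerianOrientation f A p)
    (ht : IsFaceTriangle f A i u v w) (ht' : IsFaceTriangle f A i u' v w') :
    u = u' ∧ w = w' := by
  have hval {x y : V} (hxy : A x y) : f x ≠ f y := f.valid ((h.adj_iff x y).2 (.inl hxy))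
  have hw : f w = f w' := h.color_out w v w' ht.arc₂₃ ht'.arc₂₃
  have hside : faceSide (f u) (f v) (f w) = faceSide (f u') (f v) (f w) := by
    rw [ht.side, hw, ht'.side]
  have hu : u = u' := h.eq_of_in u v u' ht.arc₁₂ ht'.arc₁₂ <|
    eq_of_faceSide_eq _ _ _ _ (hval ht.arc₁₂) (hval ht.arc₃₁).symm (hval ht'.arc₁₂)
      (hw ▸ (hval ht'.arc₃₁).symm) (hval ht.arc₂₃) hside
  exact ⟨hu, h.eq_of_in w u w' ht.arc₃₁ (hu ▸ ht'.arc₃₁) hw⟩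

theorem exists_isFaceTriangle (h : IsColorfulEulerianOrientation f A 2) (hclaw : G.ClawFree)
    (i : Bool) (v : V) : ∃ u w, IsFaceTriangle f A i u v w := by
  obtain ⟨c, d, hcd, hin⟩ := Set.ncard_eq_two.1 (h.ncard_in v)
  have hcv : A c v := (Set.ext_iff.1 hin c).2 (by simp)
  have hdv : A d v := (Set.ext_iff.1 hin d).2 (by simp)
  obtain ⟨x, hvx, hxc⟩ := h.exists_directed_triangle hclaw hcv
  obtain ⟨y, hvy, hyd⟩ := h.exists_directed_triangle hclaw hdv
  by_contra! hnone
  have hc : IsFaceTriangle f A (!i) c v x := ⟨hcv, hvx, hxc,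
    Bool.eq_not.2 fun hside => hnone c x ⟨hcv, hvx, hxc, hside⟩⟩
  have hd : IsFaceTriangle f A (!i) d v y := ⟨hdv, hvy, hyd,
    Bool.eq_not.2 fun hside => hnone d y ⟨hdv, hvy, hyd, hside⟩⟩
  exact hcd (h.eq_and_eq_of_isFaceTriangle hc hd).1

theorem neighborSet_faceTriangleGraph (h : IsColorfulEulerianOrientation f A p)
    (ht : IsFaceTriangle f A i u v w) : (faceTriangleGraph f A i).neighborSet v = {u, w} := by
  have hne {x y : V} (hxy : A x y) : x ≠ y := ((h.adj_iff x y).2 (.inl hxy)).ne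
  ext x
  simp only [mem_neighborSet, faceTriangleGraph, fromRel_adj, Set.mem_insert_iff,
    Set.mem_singleton_iff]
  constructor
  · rintro ⟨-, ⟨y, hx⟩ | ⟨y, hx⟩⟩
    · exact .inr (h.eq_and_eq_of_isFaceTriangle hx.rotate.rotate ht).2
    · exact .inl (h.eq_and_eq_of_isFaceTriangle hx ht).1
  · rintro (rfl | rfl)
    · exact ⟨(hne ht.arc₁₂).symm, .inr ⟨w, ht⟩⟩
    · exact ⟨hne ht.arc₂₃, .inl ⟨u, ht.rotate⟩⟩

theorem ncard_neighborSet_faceTriangleGraph (h : IsColorfulEulerianOrientation f A 2)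
    (hclaw : G.ClawFree) (i : Bool) (v : V) :
    ((faceTriangleGraph f A i).neighborSet v).ncard = 2 := by
  obtain ⟨u, w, ht⟩ := h.exists_isFaceTriangle hclaw i v
  rw [h.neighborSet_faceTriangleGraph ht]
  exact Set.ncard_pair ((h.adj_iff w u).2 (.inl ht.arc₃₁)).ne'

theorem isClique_neighborSet_faceTriangleGraph (h : IsColorfulEulerianOrientation f A 2)
    (hclaw : G.ClawFree) (i : Bool) (v : V) :
    (faceTriangleGraph f A i).IsClique ((faceTriangleGraph f A i).neighborSet v) := by
  obtain ⟨u, w, ht⟩ := h.exists_isFaceTriangle hclaw i v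
  rw [h.neighborSet_faceTriangleGraph ht, isClique_pair]
  exact fun hne => ⟨hne, .inr ⟨v, ht.rotate.rotate⟩⟩

theorem faceTriangleGraph_sup_eq (h : IsColorfulEulerianOrientation f A 2) (hclaw : G.ClawFree) :
    faceTriangleGraph f A false ⊔ faceTriangleGraph f A true = G := by
  have hadj {i : Bool} {x y : V} (hxy : (faceTriangleGraph f A i).Adj x y) : G.Adj x y := by
    obtain ⟨-, ⟨z, ht⟩ | ⟨z, ht⟩⟩ := hxy
    exacts [(h.adj_iff x y).2 (.inl ht.arc₁₂), (h.adj_iff x y).2 (.inr ht.arc₁₂)]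
  have harc {x y : V} (hxy : A x y) : ∃ i, (faceTriangleGraph f A i).Adj x y := by
    obtain ⟨z, hyz, hzx⟩ := h.exists_directed_triangle hclaw hxy
    exact ⟨_, ((h.adj_iff x y).2 (.inl hxy)).ne, .inl ⟨z, hxy, hyz, hzx, rfl⟩⟩
  ext x y
  rw [sup_adj, ← Bool.exists_bool (p := fun i => (faceTriangleGraph f A i).Adj x y)]
  refine ⟨fun ⟨i, hxy⟩ => hadj hxy, fun hxy => ?_⟩
  rcases (h.adj_iff x y).1 hxy with hxy | hyx
  · exact harc hxy
  · exact (harc hyx).imp fun i hi => hi.symm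

theorem eq_of_isFaceTriangle (h : IsColorfulEulerianOrientation f A p)
    (ht : IsFaceTriangle f A i u v w) (ht' : IsFaceTriangle f A j u v w') : i = j := by
  have hw : w = w' := h.eq_of_in w u w' ht.arc₃₁ ht'.arc₃₁ (h.color_out w v w' ht.arc₂₃ ht'.arc₂₃)
  rw [← ht.side, hw, ht'.side]

theorem disjoint_faceTriangleGraph (h : IsColorfulEulerianOrientation f A p) (hij : i ≠ j) :
    Disjoint (faceTriangleGraph f A i) (faceTriangleGraph f A j) := by
  refine disjoint_left.2 fun x y hi hj => ?_
  obtain ⟨-, ⟨z, ht⟩ | ⟨z, ht⟩⟩ := hi <;> obtain ⟨-, ⟨z', ht'⟩ | ⟨z', ht'⟩⟩ := hj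
  · exact hij (h.eq_of_isFaceTriangle ht ht')
  · exact h.asymm _ _ ht.arc₁₂ ht'.arc₁₂
  · exact h.asymm _ _ ht.arc₁₂ ht'.arc₁₂
  · exact hij (h.eq_of_isFaceTriangle ht ht')

end IsColorfulEulerianOrientation

end OrientedTriangles

section LineGraph

variable {α β : Type*} {P : V → α} {Q : V → β}

/-- The bipartite graph on `α ⊕ β` with an edge joining `P v` and `Q v` for every `v`. -/
def pairGraph (P : V → α) (Q : V → β) : SimpleGraph (α ⊕ β) :=
  fromEdgeSet (Set.range fun v => s(.inl (P v), .inr (Q v)))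

theorem edgeSet_pairGraph (P : V → α) (Q : V → β) :
    (pairGraph P Q).edgeSet = Set.range fun v => s(.inl (P v), .inr (Q v)) := by
  rw [pairGraph, edgeSet_fromEdgeSet, sdiff_eq_left, Set.disjoint_left]
  rintro _ ⟨v, rfl⟩
  simp

theorem isBipartite_pairGraph (P : V → α) (Q : V → β) : (pairGraph P Q).IsBipartite := by
  refine (CompleteBipartiteGraph.bicoloring α β).colorable.mono_left ?_
  rw [← edgeSet_subset_edgeSet, edgeSet_pairGraph]
  rintro _ ⟨v, rfl⟩
  simp

theorem neighborSet_pairGraph_inl (P : V → α) (Q : V → β) (a : α) :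
    (pairGraph P Q).neighborSet (.inl a) = (.inr ∘ Q) '' (P ⁻¹' {a}) := by
  ext (x | y) <;> simp [pairGraph]

theorem neighborSet_pairGraph_inr (P : V → α) (Q : V → β) (b : β) :
    (pairGraph P Q).neighborSet (.inr b) = (.inl ∘ P) '' (Q ⁻¹' {b}) := by
  ext (x | y) <;> simp [pairGraph, and_comm]

theorem ncard_neighborSet_pairGraph_inl (hPQ : Function.Injective fun v => (P v, Q v)) (a : α) :
    ((pairGraph P Q).neighborSet (.inl a)).ncard = (P ⁻¹' {a}).ncard := by
  rw [neighborSet_pairGraph_inl]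
  refine Set.InjOn.ncard_image fun u hu v hv huv => hPQ ?_
  simp_all

theorem ncard_neighborSet_pairGraph_inr (hPQ : Function.Injective fun v => (P v, Q v)) (b : β) :
    ((pairGraph P Q).neighborSet (.inr b)).ncard = (Q ⁻¹' {b}).ncard := by
  rw [neighborSet_pairGraph_inr]
  refine Set.InjOn.ncard_image fun u hu v hv huv => hPQ ?_
  simp_all

theorem nonempty_iso_lineGraph_pairGraph (hPQ : Function.Injective fun v => (P v, Q v))
    (hG : ∀ u v, G.Adj u v ↔ u ≠ v ∧ (P u = P v ∨ Q u = Q v)) :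
    Nonempty (G ≃g (pairGraph P Q).lineGraph) := by
  have hinj : Function.Injective fun v => (s(.inl (P v), .inr (Q v)) : Sym2 (α ⊕ β)) :=
    fun u v huv => hPQ (by simpa using huv)
  let e : V ≃ (pairGraph P Q).edgeSet :=
    (Equiv.ofInjective _ hinj).trans (Equiv.setCongr (edgeSet_pairGraph P Q).symm)
  have he (v : V) : (e v : Sym2 (α ⊕ β)) = s(.inl (P v), .inr (Q v)) := rfl
  refine ⟨⟨e, fun {u v} => ?_⟩⟩
  simp [lineGraph_adj_iff_exists, he, hG]

theorem connectedComponentMk_eq_iff_of_isClique_neighborSet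
    (hG : ∀ v, G.IsClique (G.neighborSet v)) {u v : V} :
    G.connectedComponentMk u = G.connectedComponentMk v ↔ u = v ∨ G.Adj v u := by
  rw [ConnectedComponent.eq, reachable_comm, reachable_iff_reflTransGen]
  constructor
  · intro h
    induction h with
    | refl => exact .inl rfl
    | @tail x y _ hxy ih =>
      rcases ih with rfl | hvx
      · exact .inr hxy
      · exact or_iff_not_imp_left.2 fun hne => hG x hvx.symm hxy (Ne.symm hne)
  · rintro (rfl | h)
    exacts [.refl, .single h]

theorem ncard_fiber_connectedComponentMk [Finite V] {d : ℕ}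
    (hG : ∀ v, G.IsClique (G.neighborSet v)) (hd : ∀ v, (G.neighborSet v).ncard = d)
    (c : G.ConnectedComponent) : (G.connectedComponentMk ⁻¹' {c}).ncard = d + 1 := by
  induction c using ConnectedComponent.ind with | _ v
  have hfiber : G.connectedComponentMk ⁻¹' {G.connectedComponentMk v} =
      insert v (G.neighborSet v) := by
    ext u
    simp [connectedComponentMk_eq_iff_of_isClique_neighborSet hG]
  rw [hfiber, Set.ncard_insert_of_notMem (by simp), hd]

theorem exists_bipartite_regular_lineGraph_iso [Finite V] {L R : SimpleGraph V} {d : ℕ}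
    (hLR : Disjoint L R) (hL : ∀ v, L.IsClique (L.neighborSet v))
    (hR : ∀ v, R.IsClique (R.neighborSet v)) (hLd : ∀ v, (L.neighborSet v).ncard = d)
    (hRd : ∀ v, (R.neighborSet v).ncard = d) :
    ∃ H : SimpleGraph (L.ConnectedComponent ⊕ R.ConnectedComponent), H.IsBipartite ∧
      (∀ x, (H.neighborSet x).ncard = d + 1) ∧ Nonempty (L ⊔ R ≃g H.lineGraph) := by
  let P := L.connectedComponentMk
  let Q := R.connectedComponentMk
  have hP {u v : V} : P u = P v ↔ u = v ∨ L.Adj v u :=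
    connectedComponentMk_eq_iff_of_isClique_neighborSet hL
  have hQ {u v : V} : Q u = Q v ↔ u = v ∨ R.Adj v u :=
    connectedComponentMk_eq_iff_of_isClique_neighborSet hR
  have hPQ : Function.Injective fun v => (P v, Q v) := by
    intro u v huv
    obtain ⟨hLuv, hRuv⟩ := Prod.ext_iff.1 huv
    by_contra hne
    exact disjoint_left.1 hLR _ _ ((hP.1 hLuv).resolve_left hne) ((hQ.1 hRuv).resolve_left hne)
  refine ⟨pairGraph P Q, isBipartite_pairGraph P Q, ?_,
    nonempty_iso_lineGraph_pairGraph hPQ fun u v => ?_⟩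
  · rintro (a | b)
    · rw [ncard_neighborSet_pairGraph_inl hPQ, ncard_fiber_connectedComponentMk hL hLd]
    · rw [ncard_neighborSet_pairGraph_inr hPQ, ncard_fiber_connectedComponentMk hR hRd]
  · have hLne := L.ne_of_adj (a := v) (b := u)
    have hRne := R.ne_of_adj (a := v) (b := u)
    rw [hP, hQ, sup_adj, L.adj_comm, R.adj_comm]
    grind

theorem exists_fin_regular_iso [Finite W] {d : ℕ} (H : SimpleGraph W)
    (hd : ∀ x, (H.neighborSet x).ncard = d) :
    ∃ (n : ℕ) (H' : SimpleGraph (Fin n)) (_ : H'.LocallyFinite),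
      H'.IsRegularOfDegree d ∧ Nonempty (H ≃g H') := by
  cases nonempty_fintype W
  let e := H.overFinIso rfl
  let hfin : (H.overFin rfl).LocallyFinite := fun _ => Fintype.ofFinite _
  refine ⟨_, H.overFin rfl, hfin, fun x => ?_, ⟨e⟩⟩
  rw [degree_eq_ncard_neighborSet, ← hd (e.symm x)]
  exact Nat.card_congr (e.symm.mapNeighborSet x)

end LineGraph

section OddHoles

open Fin.CommRing in
theorem ne_and_not_cycleGraph_adj_add_one_add_one {n : ℕ} (hn : 1 ≤ n) (i : Fin (n + 3)) :
    i ≠ i + 1 + 1 ∧ ¬ (cycleGraph (n + 3)).Adj i (i + 1 + 1) := by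
  have hcast (k : ℕ) (hk : 0 < k) (hkn : k < n + 3) : (k : Fin (n + 3)) ≠ 0 :=
    (Fin.natCast_eq_zero).not.2 (Nat.not_dvd_of_pos_of_lt hk hkn)
  have h1 := hcast 1 (by omega) (by omega)
  have h2 := hcast 2 (by omega) (by omega)
  have h3 := hcast 3 (by omega) (by omega)
  push_cast at h1 h2 h3
  rw [cycleGraph_adj]
  refine ⟨fun h => h2 (by linear_combination -h), ?_⟩
  rintro (h | h)
  · exact h3 (by linear_combination -h)
  · exact h1 (by linear_combination h)

theorem eq_of_mem_edgeSet_of_color_eq {α : Type*} (c : G.Coloring α) {e : Sym2 V}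
    (he : e ∈ G.edgeSet) {x y : V} (hx : x ∈ e) (hy : y ∈ e) (hxy : c x = c y) : x = y := by
  by_contra hne
  rw [(Sym2.mem_and_mem_iff hne).1 ⟨hx, hy⟩] at he
  exact c.valid he hxy

theorem oddHoleFree_lineGraph (hG : G.IsBipartite) : G.lineGraph.OddHoleFree := by
  rintro q hq ⟨w⟩
  obtain ⟨c⟩ := hG
  have hstep (i : Fin (2 * q + 3)) : (cycleGraph (2 * q + 3)).Adj i (i + 1) :=
    cycleGraph_adj.2 (.inr (add_sub_cancel_left i 1))
  choose x hx hx_succ using fun i =>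
    (lineGraph_adj_iff_exists.1 (w.map_adj_iff.2 (hstep i))).2
  have halternate (i : Fin (2 * q + 3)) : c (x i) ≠ c (x (i + 1)) := by
    intro hc
    have hxx : x i = x (i + 1) :=
      eq_of_mem_edgeSet_of_color_eq c (w (i + 1)).2 (hx_succ i) (hx (i + 1)) hc
    obtain ⟨hne, hchord⟩ := ne_and_not_cycleGraph_adj_add_one_add_one (n := 2 * q) (by omega) i
    exact hchord <| w.map_adj_iff.1 <|
      lineGraph_adj_iff_exists.2 ⟨w.injective.ne hne, x i, hx i, hxx ▸ hx_succ (i + 1)⟩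
  have hcolorable : (cycleGraph (2 * q + 3)).Colorable 2 := by
    refine ⟨Coloring.mk (c ∘ x) fun {i j} hij => ?_⟩
    rcases cycleGraph_adj.1 hij with hij | hij
    · obtain rfl := sub_eq_iff_eq_add'.1 hij
      exact (halternate j).symm
    · obtain rfl := sub_eq_iff_eq_add'.1 hij
      exact halternate i
  have hthree := chromaticNumber_cycleGraph_of_odd (2 * q + 3) (by omega) ⟨q + 1, by ring⟩
  have := hcolorable.chromaticNumber_le
  rw [hthree] at this
  exact absurd this (by norm_num)

theorem oddHoleFree_of_iso {H : SimpleGraph W} (e : G ≃g H) (hH : H.OddHoleFree) :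
    G.OddHoleFree :=
  fun q hq ⟨w⟩ => hH q hq ⟨e.toEmbedding.comp w⟩

end OddHoles

end

theorem mainTheorem8 {V : Type*} [Fintype V] (G : SimpleGraph V) [G.LocallyFinite]
    (hreg : G.IsRegularOfDegree 4) (hclaw : G.ClawFree) (hstar : G.StarColorable 4) :
    (∃ (n : ℕ) (H : SimpleGraph (Fin n)) (_ : H.LocallyFinite),
      H.IsBipartite ∧ H.IsRegularOfDegree 3 ∧ Nonempty (G ≃g H.lineGraph)) ∧
    G.OddHoleFree := by
  obtain ⟨f, hf⟩ := hstar
  have h := isColorfulEulerianOrientation_isUniqueNeighbor (p := 2) le_rfl hreg hf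
  obtain ⟨H, hbip, hdeg, ⟨e⟩⟩ := exists_bipartite_regular_lineGraph_iso
    (h.disjoint_faceTriangleGraph Bool.false_ne_true)
    (h.isClique_neighborSet_faceTriangleGraph hclaw false)
    (h.isClique_neighborSet_faceTriangleGraph hclaw true)
    (h.ncard_neighborSet_faceTriangleGraph hclaw false)
    (h.ncard_neighborSet_faceTriangleGraph hclaw true)
  rw [h.faceTriangleGraph_sup_eq hclaw] at e
  obtain ⟨n, H', hfin, hreg', ⟨e'⟩⟩ := exists_fin_regular_iso H hdeg
  exact ⟨⟨n, H', hfin, hbip.of_hom e'.symm.toHom, hreg', ⟨e'.lineGraph.comp e⟩⟩,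
    oddHoleFree_of_iso e (oddHoleFree_lineGraph hbip)⟩
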